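/- Let $d\ge 2$ and let ${\bf X}=(X_1,X_2,{\bf X}_J)$ be a random vector in $\mathbb R^d$ with law $\mathbb P$, where ${\bf X}_J=(X_3,\dots,X_d)\in\mathbb R^{d-2}$. Let $A_1,\dots,A_m$ be Borel subsets of $\mathbb R^{d-2}$, possibly overlapping, with $p_k:=\mathbb P({\bf X}_J\in A_k)>0$ for every $k$. Let ${\bf X}_1,{\bf X}_2,\dots$ be i.i.d. copies of ${\bf X}$, ${\bf X}_i=(X_{i,1},X_{i,2},{\bf X}_{i,J})$. For $k=1,\dots,m$ put $$\hat D_k:=\frac1{n(n-1)}\sum_{i=1}^n\sum_{j=1,\,j\ne i}^n{\bf 1}\{X_{i,1}<X_{j,1},\ X_{i,2}<X_{j,2},\ {\bf X}_{i,J}\in A_k,\ {\bf X}_{j,J}\in A_k\},\qquad \hat p_k:=\frac1n\sum_{i=1}^n{\bf 1}\{{\bf X}_{i,J}\in A_k\},$$ $$D_k:=\mathbb P\big(X_{1,1}<X_{2,1},\ X_{1,2}<X_{2,2},\ {\bf X}_{1,J}\in A_k,\ {\bf X}_{2,J}\in A_k\big).$$ Let $\mathbb P_k(d{\bf x}):={\bf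 1}\{{\bf x}_J\in A_k\}\,\mathbb P(d{\bf x})/p_k$ be the law of ${\bf X}$ given ${\bf X}_J\in A_k$, let $\pi({\bf x},{\bf y}):=\frac12\big({\bf 1}\{x_1<y_1,x_2<y_2\}+{\bf 1}\{y_1<x_1,y_2<x_2\}\big)$, and for $k,l\in\{1,\dots,m\}$ let $$I_{k,l}:=\int{\bf 1}\{{\bf x}_{3,J}\in A_k\cap A_l\}\,\pi({\bf x}_1,{\bf x}_3)\,\pi({\bf x}_2,{\bf x}_3)\,\mathbb P_k(d{\bf x}_1)\,\mathbb P_l(d{\bf x}_2)\,\mathbb P(d{\bf x}_3),$$ $$J_{k,l}:=\int{\bf 1}\{{\bf x}_{2,J}\in A_k\cap A_l\}\,\pi({\bf x}_1,{\bf x}_2)\,\mathbb P_k(d{\bf x}_1)\,\mathbb P(d{\bf x}_2),\qquad p_{k,l}:=\mathbb P({\bf X}_J\in A_k\cap A_l).$$ Let $\hat{\bf V}:=(\hat D_1-D_1,\dots,\hat D_m-D_m,\hat p_1-p_1,\dots,\hat p_m-p_m)'$ and $$\Sigma:=\begin{bmatrix}\Sigma_{1,1}&\Sigma_{1,2}\\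 \Sigma_{1,2}'&\Sigma_{2,2}\end{bmatrix},\qquad \Sigma_{1,1}:=[4p_kp_lI_{k,l}-4D_kD_l]_{k,l},\quad \Sigma_{1,2}:=[2p_kJ_{k,l}-2D_kp_l]_{k,l},\quad \Sigma_{2,2}:=[p_{k,l}-p_kp_l]_{k,l}.$$ Then $\Sigma$ is symmetric positive semidefinite and, as $n\to\infty$, $\sqrt n\,\hat{\bf V}$ converges in law to the $2m$-dimensional Gaussian distribution $\mathcal N(0,\Sigma)$. -/

import Mathlib

open MeasureTheory ProbabilityTheory Filter

noncomputable section

namespace CondKendall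

/-- The space `ℝ^d` with `d = q + 2`: the coordinates `0, 1` are the conditioned variables
(the block `I`), the remaining `q` coordinates are the conditioning variables (the block `J`). -/
abbrev Vec (q : ℕ) : Type := Fin (q + 2) → ℝ

/-- The conditioning block `x_J` of `x`. -/
def blockJ {q : ℕ} (x : Vec q) : Fin q → ℝ := fun j => x j.succ.succ

/-- The event `{x_J ∈ A}`, as a subset of `ℝ^d`. -/
def condEvent {q : ℕ} (A : Set (Fin q → ℝ)) : Set (Vec q) := {x | blockJ x ∈ A}

/-- The pairs `(x, y)` with `x₁ < y₁` and `x₂ < y₂`. -/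
def ltPairs (q : ℕ) : Set (Vec q × Vec q) := {z | z.1 0 < z.2 0 ∧ z.1 1 < z.2 1}

/-- The pairs `(x, y)` with `x₁ < y₁`, `x₂ < y₂`, `x_J ∈ A` and `y_J ∈ A`. -/
def concPairs {q : ℕ} (A : Set (Fin q → ℝ)) : Set (Vec q × Vec q) :=
  {z | z.1 0 < z.2 0 ∧ z.1 1 < z.2 1 ∧ blockJ z.1 ∈ A ∧ blockJ z.2 ∈ A}

/-- The U-statistic
`D̂ = (n (n - 1))⁻¹ ∑_{i} ∑_{j ≠ i} 1{X_{i,1} < X_{j,1}, X_{i,2} < X_{j,2}, X_{i,J} ∈ A, X_{j,J} ∈ A}`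
of the sample `x 0, …, x (n - 1)`. -/
def DHat {q : ℕ} (A : Set (Fin q → ℝ)) (n : ℕ) (x : ℕ → Vec q) : ℝ :=
  1 / ((n : ℝ) * ((n : ℝ) - 1)) *
    ∑ i ∈ Finset.range n, ∑ j ∈ (Finset.range n).erase i,
      (concPairs A).indicator (fun _ => (1 : ℝ)) (x i, x j)

/-- The empirical frequency of `{X_J ∈ A}` in the sample `x 0, …, x (n - 1)`. -/
def pHat {q : ℕ} (A : Set (Fin q → ℝ)) (n : ℕ) (x : ℕ → Vec q) : ℝ :=
  1 / (n : ℝ) * ∑ i ∈ Finset.range n, (condEvent A).indicator (fun _ => (1 : ℝ)) (x i)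

/-- `D = ℙ(X₁ < Y₁, X₂ < Y₂, X_J ∈ A, Y_J ∈ A)` for independent `X, Y` with law `ν`. -/
def D {q : ℕ} (ν : Measure (Vec q)) (A : Set (Fin q → ℝ)) : ℝ :=
  (ν.prod ν).real (concPairs A)

/-- `p = ℙ(X_J ∈ A)` for `X` with law `ν`. -/
def p {q : ℕ} (ν : Measure (Vec q)) (A : Set (Fin q → ℝ)) : ℝ := ν.real (condEvent A)

/-- The conditional law of `X` given `X_J ∈ A`. -/
def condLaw {q : ℕ} (ν : Measure (Vec q)) (A : Set (Fin q → ℝ)) : Measure (Vec q) :=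
  ProbabilityTheory.cond ν (condEvent A)

/-- The symmetrized kernel
`π(x, y) = (1{x₁ < y₁, x₂ < y₂} + 1{y₁ < x₁, y₂ < x₂}) / 2`. -/
def symKernel {q : ℕ} (x y : Vec q) : ℝ :=
  ((ltPairs q).indicator (fun _ => (1 : ℝ)) (x, y) +
    (ltPairs q).indicator (fun _ => (1 : ℝ)) (y, x)) / 2

/-- `I_{A,B} = ∫ 1{x₃,J ∈ A ∩ B} π(x₁, x₃) π(x₂, x₃) ℙ_A(dx₁) ℙ_B(dx₂) ℙ(dx₃)`. -/
def intI {q : ℕ} (ν : Measure (Vec q)) (A B : Set (Fin q → ℝ)) : ℝ :=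
  ∫ x₃, ∫ x₂, ∫ x₁,
    (condEvent (A ∩ B)).indicator (fun _ => (1 : ℝ)) x₃ * symKernel x₁ x₃ * symKernel x₂ x₃
    ∂(condLaw ν A) ∂(condLaw ν B) ∂ν

/-- `J_{A,B} = ∫ 1{x₂,J ∈ A ∩ B} π(x₁, x₂) ℙ_A(dx₁) ℙ(dx₂)`. -/
def intJ {q : ℕ} (ν : Measure (Vec q)) (A B : Set (Fin q → ℝ)) : ℝ :=
  ∫ x₂, ∫ x₁,
    (condEvent (A ∩ B)).indicator (fun _ => (1 : ℝ)) x₂ * symKernel x₁ x₂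
    ∂(condLaw ν A) ∂ν

/-- The vector `V̂ = (D̂_1 - D_1, …, D̂_m - D_m, p̂_1 - p_1, …, p̂_m - p_m)`; the index type
`Fin m ⊕ Fin m` has `2 m` elements. -/
def VHat {q m : ℕ} (ν : Measure (Vec q)) (A : Fin m → Set (Fin q → ℝ)) (n : ℕ)
    (x : ℕ → Vec q) : EuclideanSpace ℝ (Fin m ⊕ Fin m) :=
  WithLp.toLp 2 (Sum.elim (fun k => DHat (A k) n x - D ν (A k))
    (fun k => pHat (A k) n x - p ν (A k)))

/-- The block `Σ₁₁ = [4 p_k p_l I_{k,l} - 4 D_k D_l]`. -/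
def Sigma11 {q m : ℕ} (ν : Measure (Vec q)) (A : Fin m → Set (Fin q → ℝ)) :
    Matrix (Fin m) (Fin m) ℝ :=
  Matrix.of fun k l =>
    4 * p ν (A k) * p ν (A l) * intI ν (A k) (A l) - 4 * D ν (A k) * D ν (A l)

/-- The block `Σ₁₂ = [2 p_k J_{k,l} - 2 D_k p_l]`. -/
def Sigma12 {q m : ℕ} (ν : Measure (Vec q)) (A : Fin m → Set (Fin q → ℝ)) :
    Matrix (Fin m) (Fin m) ℝ :=
  Matrix.of fun k l => 2 * p ν (A k) * intJ ν (A k) (A l) - 2 * D ν (A k) * p ν (A l)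

/-- The block `Σ₂₂ = [p_{k,l} - p_k p_l]`, where `p_{k,l} = ℙ(X_J ∈ A_k ∩ A_l)`. -/
def Sigma22 {q m : ℕ} (ν : Measure (Vec q)) (A : Fin m → Set (Fin q → ℝ)) :
    Matrix (Fin m) (Fin m) ℝ :=
  Matrix.of fun k l => p ν (A k ∩ A l) - p ν (A k) * p ν (A l)

/-- The covariance matrix `Σ = [[Σ₁₁, Σ₁₂], [Σ₁₂', Σ₂₂]]`. -/
def SigmaMat {q m : ℕ} (ν : Measure (Vec q)) (A : Fin m → Set (Fin q → ℝ)) :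
    Matrix (Fin m ⊕ Fin m) (Fin m ⊕ Fin m) ℝ :=
  Matrix.fromBlocks (Sigma11 ν A) (Sigma12 ν A) (Sigma12 ν A).transpose (Sigma22 ν A)

end CondKendall

end

/-! Up to an error vanishing in probability, `√n • VHat` is a normalized sum of i.i.d. centered
vectors, so the classical central limit theorem decides the limit. The frequencies are such sums
already. Each `DHat` is a U-statistic of order two, and `hoeffding_decomposition` splits it into the
average of the centered Hájek projection and a doubly degenerate remainder. Two remainder terms are
uncorrelated unless they use the same unordered pair of indices (`integral_mul_eq_zero_of_ne`), so
the remainder, scaled by `√n`, has second moment `O(1/n)` (`integral_sq_sum_offDiag_le`).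

The projection of the concordance kernel is `2 p_k 1{x_J ∈ A_k} ∫ π(y, x) ℙ_k(dy)`, with mean `2
D_k` (`hajekProj_concKernel`, `integral_influence_inl`). Its covariances, and those with the
indicators, are the entries of `Σ` (`covariance_influence`); overlaps of the sets enter only through
`1_{A ∩ B} = 1_A 1_B`. Being a covariance matrix, `Σ` is positive semidefinite. -/

/-! ### Multivariate central limit theorem by the Cramér–Wold device. -/

section CentralLimit

open scoped RealInnerProductSpace Topology Matrix

variable {Ω E ι : Type*} [MeasurableSpace Ω] [MeasurableSpace E] [Fintype ι]
  {P : Measure Ω} [IsProbabilityMeasure P] {ν : Measure E} [IsProbabilityMeasure ν]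

/-- The variance of a linear combination is the quadratic form of the covariance matrix. -/
lemma variance_linearCombination (F : ι → E → ℝ) (hF : ∀ a, MemLp (F a) 2 ν) (t : ι → ℝ) :
    Var[fun x => ∑ a, t a * F a x; ν] =
      t ⬝ᵥ (Matrix.of fun a b => cov[F a, F b; ν]) *ᵥ t := by
  rw [variance_fun_sum (fun a => (hF a).const_mul (t a))]
  simp only [dotProduct, Matrix.mulVec, Matrix.of_apply, Finset.mul_sum]
  refine Finset.sum_congr rfl fun a _ => Finset.sum_congr rfl fun b _ => ?_
  rw [covariance_const_mul_left, covariance_const_mul_right]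
  ring

lemma posSemidef_covariance (F : ι → E → ℝ) (hF : ∀ a, MemLp (F a) 2 ν) :
    (Matrix.of fun a b => cov[F a, F b; ν]).PosSemidef := by
  refine Matrix.PosSemidef.of_dotProduct_mulVec_nonneg ?_ fun t => ?_
  · ext a b
    simp [covariance_comm]
  · rw [star_trivial, ← variance_linearCombination F hF]
    exact variance_nonneg _ _

/-- **Multivariate central limit theorem** for `F ∘ X i` with `X i` i.i.d. of law `ν`. -/
theorem tendstoInDistribution_multivariate [DecidableEq ι] {X : ℕ → Ω → E}
    (hindep : iIndepFun X P) (hlaw : ∀ i, HasLaw (X i) ν P)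
    (F : ι → E → ℝ) (hFm : ∀ a, Measurable (F a)) (hF : ∀ a, MemLp (F a) 2 ν) :
    TendstoInDistribution
      (fun (n : ℕ) ω => WithLp.toLp 2 fun a =>
        (√(n : ℝ))⁻¹ * (∑ i ∈ Finset.range n, F a (X i ω) - n * ∫ x, F a x ∂ν))
      atTop id (fun _ => P)
      (multivariateGaussian 0 (Matrix.of fun a b => cov[F a, F b; ν])) := by
  have hX i : AEMeasurable (X i) P := (hlaw i).aemeasurable
  have hmeas (n : ℕ) : AEMeasurable (fun ω => WithLp.toLp 2 fun a =>
        (√(n : ℝ))⁻¹ * (∑ i ∈ Finset.range n, F a (X i ω) - n * ∫ x, F a x ∂ν)) P := by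
    refine (WithLp.measurable_toLp 2 (ι → ℝ)).comp_aemeasurable ?_
    refine aemeasurable_pi_lambda _ fun a => ?_
    refine ((Finset.aemeasurable_fun_sum _ fun i _ => ?_).sub_const _).const_mul _
    exact (hFm a).comp_aemeasurable (hX i)
  refine ⟨hmeas, aemeasurable_id, ?_⟩
  -- Lévy continuity plus Cramér–Wold: the characteristic function of the vector at `t` is that of
  -- its scalar projection `⟪·, t⟫` at `1`, and this projection is the normalized sum of the i.i.d.
  -- variables `f (X i)`.
  refine ProbabilityMeasure.tendsto_iff_tendsto_charFun.2 fun t => ?_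
  set f : E → ℝ := fun x => ∑ a, t a * F a x with hf
  have hfm : Measurable f := Finset.measurable_fun_sum _ fun a _ => (hFm a).const_mul _
  have hfL : MemLp f 2 ν := memLp_finsetSum _ fun a _ => (hF a).const_mul _
  have hlf i : HasLaw (fun ω => f (X i ω)) (ν.map f) P :=
    HasLaw.fun_comp ⟨hfm.aemeasurable, rfl⟩ (hlaw i)
  have hvar : Var[fun ω => f (X 0 ω); P] = Var[f; ν] := by
    rw [← (hlaw 0).map_eq, variance_map (by fun_prop) (hX 0)]
    rfl
  have hint : ∫ ω, f (X 0 ω) ∂P = ∫ x, f x ∂ν :=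
    (hlaw 0).integral_comp hfm.aestronglyMeasurable
  have hmem : MemLp (fun ω => f (X 0 ω)) 2 P := by
    have := hfL
    rw [← (hlaw 0).map_eq] at this
    exact (memLp_map_measure_iff hfm.aestronglyMeasurable (hX 0)).1 this
  have clt := tendstoInDistribution_inv_sqrt_mul_sum_sub (P := P)
    (X := fun i ω => f (X i ω)) (Y := id)
    (P' := gaussianReal 0 Var[fun ω => f (X 0 ω); P].toNNReal) HasLaw.id hmem
    (hindep.comp (fun _ => f) fun _ => hfm)
    (fun i => ⟨(hlf i).aemeasurable, (hlf 0).aemeasurable, by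
      rw [(hlf i).map_eq, (hlf 0).map_eq]⟩)
  have key := ProbabilityMeasure.tendsto_iff_tendsto_charFun.1 clt.tendsto 1
  simp only [ProbabilityMeasure.coe_mk, Measure.map_id] at key ⊢
  have hlim : charFun (gaussianReal 0 Var[fun ω => f (X 0 ω); P].toNNReal) 1 =
      charFun (multivariateGaussian 0 (Matrix.of fun a b => cov[F a, F b; ν])) t := by
    rw [charFun_multivariateGaussian (posSemidef_covariance F hF), charFun_gaussianReal,
      ← variance_linearCombination F hF, hvar, Real.coe_toNNReal _ (variance_nonneg _ _)]
    simp [hf]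
  rw [← hlim]
  refine key.congr fun n => ?_
  rw [charFun_apply, charFun_apply, integral_map (hmeas n) (by fun_prop),
    integral_map (clt.forall_aemeasurable n) (by fun_prop)]
  congr with ω
  congr 3
  have hint' : ∫ x, f x ∂ν = ∑ a, t a * ∫ x, F a x ∂ν := by
    rw [hf, integral_finsetSum _ fun a _ => ((hF a).integrable (by norm_num)).const_mul _]
    simp_rw [integral_const_mul]
  rw [hint, hint']
  simp only [PiLp.inner_apply, RCLike.inner_apply, conj_trivial, one_mul, hf]
  rw [Finset.sum_comm, Finset.mul_sum, ← Finset.sum_sub_distrib, Finset.mul_sum]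
  refine Finset.sum_congr rfl fun a _ => ?_
  rw [← Finset.mul_sum]
  ring

end CentralLimit

/-! ### U-statistics of order two: degenerate kernels and the Hoeffding decomposition. -/

section UStatistic

variable {Ω E : Type*} [MeasurableSpace Ω] [MeasurableSpace E]
  {P : Measure Ω} [IsProbabilityMeasure P] {ν : Measure E} [IsProbabilityMeasure ν]

lemma integral_eq_zero_of_indepFun {W : Type*} [MeasurableSpace W] {U : Ω → E} {V : Ω → W}
    (hU : HasLaw U ν P) (hV : AEMeasurable V P) (hUV : IndepFun U V P)
    {f : E → W → ℝ} (hf : Measurable f.uncurry) {C : ℝ} (hC : ∀ u w, |f u w| ≤ C)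
    (h0 : ∀ w, ∫ u, f u w ∂ν = 0) : ∫ ω, f (U ω) (V ω) ∂P = 0 := by
  have : IsProbabilityMeasure (P.map V) := Measure.isProbabilityMeasure_map hV
  have h := (indepFun_iff_map_prod_eq_prod_map_map hU.aemeasurable hV).1 hUV
  calc ∫ ω, f (U ω) (V ω) ∂P = ∫ z, f.uncurry z ∂(P.map fun ω => (U ω, V ω)) :=
        (integral_map (hU.aemeasurable.prodMk hV) hf.aestronglyMeasurable).symm
    _ = 0 := by
        rw [h, hU.map_eq, integral_prod_symm]
        · simp [Function.uncurry, h0]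
        · exact .of_bound hf.aestronglyMeasurable C (ae_of_all _ fun z => hC z.1 z.2)

variable {X : ℕ → Ω → E} {r s h : E → E → ℝ} {C : ℝ}

/-- `X i` occurs only once and is independent of the other variables, so integrating it out first
kills the product. -/
lemma integral_mul_eq_zero_of_notMem (hindep : iIndepFun X P)
    (hlaw : ∀ i, HasLaw (X i) ν P) (hr : Measurable r.uncurry) (hs : Measurable s.uncurry)
    (hrC : ∀ x y, |r x y| ≤ C) (hsC : ∀ x y, |s x y| ≤ C)
    (h0 : ∀ y, ∫ x, r x y ∂ν = 0) {i j k l : ℕ} (hij : i ≠ j) (hik : i ≠ k) (hil : i ≠ l) :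
    ∫ ω, r (X i ω) (X j ω) * s (X k ω) (X l ω) ∂P = 0 := by
  have hX i : AEMeasurable (X i) P := (hlaw i).aemeasurable
  -- The indices `j, k, l` may coincide, so the remaining variables are indexed by a finset rather
  -- than taken as a triple.
  let T : Finset ℕ := {j, k, l}
  have hj : j ∈ T := by simp [T]
  have hk : k ∈ T := by simp [T]
  have hl : l ∈ T := by simp [T]
  have hdisj : Disjoint ({i} : Finset ℕ) T := by simp [T, hij, hik, hil]
  have ind : IndepFun (X i) (fun ω (a : T) => X a ω) P :=
    (hindep.indepFun_finset₀ _ _ hdisj hX).comp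
      (measurable_pi_apply (⟨i, by simp⟩ : ({i} : Finset ℕ))) measurable_id
  refine integral_eq_zero_of_indepFun (W := T → E) (V := fun ω (a : T) => X a ω)
    (f := fun u w => r u (w ⟨j, hj⟩) * s (w ⟨k, hk⟩) (w ⟨l, hl⟩)) (hlaw i)
    (aemeasurable_pi_lambda _ fun a => hX a) ind ?_ (C := C * C) (fun u w => ?_) fun w => ?_
  · exact Measurable.mul
      (hr.comp (f := fun z : E × (T → E) => (z.1, z.2 ⟨j, hj⟩)) (by fun_prop))
      (hs.comp (f := fun z : E × (T → E) => (z.2 ⟨k, hk⟩, z.2 ⟨l, hl⟩)) (by fun_prop))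
  · rw [abs_mul]
    exact mul_le_mul (hrC _ _) (hsC _ _) (abs_nonneg _) ((abs_nonneg _).trans (hrC u u))
  · rw [integral_mul_const, h0, zero_mul]

/-- Orthogonality of the terms of a degenerate U-statistic of order two. -/
lemma integral_mul_eq_zero_of_ne (hindep : iIndepFun X P)
    (hlaw : ∀ i, HasLaw (X i) ν P) (hr : Measurable r.uncurry) (hC : ∀ x y, |r x y| ≤ C)
    (h0 : ∀ y, ∫ x, r x y ∂ν = 0) (h0' : ∀ x, ∫ y, r x y ∂ν = 0)
    {a b : ℕ × ℕ} (ha : a.1 ≠ a.2) (hb : b.1 ≠ b.2) (hab : b ≠ a) (hab' : b ≠ a.swap) :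
    ∫ ω, r (X a.1 ω) (X a.2 ω) * r (X b.1 ω) (X b.2 ω) ∂P = 0 := by
  obtain ⟨i, j⟩ := a
  obtain ⟨k, l⟩ := b
  simp only [ne_eq, Prod.mk.injEq, Prod.swap_prod_mk] at *
  by_cases hi : i ≠ k ∧ i ≠ l
  · exact integral_mul_eq_zero_of_notMem hindep hlaw hr hr hC hC h0 ha hi.1 hi.2
  -- If `i` is one of `k, l`, then `j` is neither: otherwise `b` would be `a` or its swap, or `i =
  -- j`. So some index of `a` is always absent from `b`.
  · have hj : j ≠ k ∧ j ≠ l := by grind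
    exact integral_mul_eq_zero_of_notMem (r := fun x y => r y x) hindep hlaw
      (hr.comp measurable_swap) hr (fun x y => hC y x) hC h0' (Ne.symm ha) hj.1 hj.2

/-- Second moment bound for a degenerate U-statistic of order two. -/
lemma integral_sq_sum_offDiag_le (hindep : iIndepFun X P)
    (hlaw : ∀ i, HasLaw (X i) ν P) (hr : Measurable r.uncurry) (hC : ∀ x y, |r x y| ≤ C)
    (h0 : ∀ y, ∫ x, r x y ∂ν = 0) (h0' : ∀ x, ∫ y, r x y ∂ν = 0) (n : ℕ) :
    ∫ ω, (∑ a ∈ (Finset.range n).offDiag, r (X a.1 ω) (X a.2 ω)) ^ 2 ∂P ≤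
      2 * C ^ 2 * (n * (n - 1)) := by
  have hX i : AEMeasurable (X i) P := (hlaw i).aemeasurable
  have hC2 (x y z w : E) : |r x y * r z w| ≤ C ^ 2 := by
    rw [abs_mul, sq]
    exact mul_le_mul (hC _ _) (hC _ _) (abs_nonneg _) ((abs_nonneg _).trans (hC x y))
  have hrm i j : AEMeasurable (fun ω => r (X i ω) (X j ω)) P :=
    hr.comp_aemeasurable ((hX i).prodMk (hX j))
  have hint (a b : ℕ × ℕ) :
      Integrable (fun ω => r (X a.1 ω) (X a.2 ω) * r (X b.1 ω) (X b.2 ω)) P :=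
    .of_bound ((hrm _ _).mul (hrm _ _)).aestronglyMeasurable (C ^ 2)
      (ae_of_all _ fun ω => hC2 _ _ _ _)
  have hle (a b : ℕ × ℕ) (ha : a.1 ≠ a.2) (hb : b.1 ≠ b.2) :
      ∫ ω, r (X a.1 ω) (X a.2 ω) * r (X b.1 ω) (X b.2 ω) ∂P ≤
        if b ∈ ({a, a.swap} : Finset (ℕ × ℕ)) then C ^ 2 else 0 := by
    split_ifs with hab
    · calc _ ≤ ∫ _ω, C ^ 2 ∂P :=
            integral_mono (hint a b) (integrable_const _) fun ω =>
              (le_abs_self _).trans (hC2 _ _ _ _)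
        _ = C ^ 2 := by simp
    · simp only [Finset.mem_insert, Finset.mem_singleton, not_or] at hab
      exact (integral_mul_eq_zero_of_ne hindep hlaw hr hC h0 h0' ha hb hab.1 hab.2).le
  simp_rw [sq (∑ a ∈ _, _), Finset.sum_mul_sum]
  rw [integral_finsetSum _ fun a _ => integrable_finsetSum _ fun b _ => hint a b]
  calc _ ≤ ∑ _a ∈ (Finset.range n).offDiag, 2 * C ^ 2 := by
        refine Finset.sum_le_sum fun a ha => ?_
        rw [integral_finsetSum _ fun b _ => hint a b]
        refine (Finset.sum_le_sum fun b hb => hle a b (Finset.mem_offDiag.1 ha).2.2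
          (Finset.mem_offDiag.1 hb).2.2).trans ?_
        rw [← Finset.sum_filter, Finset.sum_const, nsmul_eq_mul]
        refine mul_le_mul_of_nonneg_right ?_ (sq_nonneg C)
        -- Each `a` interacts only with itself and its swap: this is the factor `2` in the bound.
        have h2 : (((Finset.range n).offDiag.filter (· ∈ ({a, a.swap} : Finset (ℕ × ℕ)))).card)
            ≤ 2 := (Finset.card_le_card fun b hb => (Finset.mem_filter.1 hb).2).trans
              Finset.card_le_two
        exact_mod_cast h2
    _ = 2 * C ^ 2 * (n * (n - 1)) := by
        rw [Finset.sum_const, Finset.offDiag_card, nsmul_eq_mul, Finset.card_range,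
          Nat.cast_sub (Nat.le_mul_self n)]
        push_cast
        ring

/-- The first-order (Hájek) projection `x ↦ E h(x, Y) + E h(Y, x)` of a kernel `h`. -/
noncomputable def hajekProj (ν : Measure E) (h : E → E → ℝ) (x : E) : ℝ :=
  ∫ y, h x y ∂ν + ∫ y, h y x ∂ν

/-- The degenerate part of a kernel `h` in its Hoeffding decomposition. -/
noncomputable def hoeffdingRem (ν : Measure E) (h : E → E → ℝ) (x y : E) : ℝ :=
  h x y - ∫ z, h x z ∂ν - ∫ z, h z y ∂ν + ∫ z, h z.1 z.2 ∂(ν.prod ν)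

lemma measurable_integral_left (hm : Measurable h.uncurry) :
    Measurable fun x => ∫ y, h x y ∂ν :=
  (hm.stronglyMeasurable.integral_prod_right' (ν := ν)).measurable

lemma measurable_integral_right (hm : Measurable h.uncurry) :
    Measurable fun y => ∫ x, h x y ∂ν :=
  (hm.stronglyMeasurable.integral_prod_left' (μ := ν)).measurable

lemma measurable_hajekProj (hm : Measurable h.uncurry) : Measurable (hajekProj ν h) :=
  (measurable_integral_left hm).add (measurable_integral_right hm)

lemma measurable_hoeffdingRem (hm : Measurable h.uncurry) :
    Measurable (hoeffdingRem ν h).uncurry := by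
  refine ((hm.sub ?_).sub ?_).add_const _
  · exact (measurable_integral_left hm).comp measurable_fst
  · exact (measurable_integral_right hm).comp measurable_snd

lemma abs_integral_le_of_abs_le {F : Type*} [MeasurableSpace F] {μ : Measure F}
    [IsProbabilityMeasure μ] {f : F → ℝ} (hf : ∀ x, |f x| ≤ C) : |∫ x, f x ∂μ| ≤ C := by
  simpa using norm_integral_le_of_norm_le_const (μ := μ) (f := f) (ae_of_all _ hf)

lemma abs_hajekProj_le (hC : ∀ x y, |h x y| ≤ C) (x : E) : |hajekProj ν h x| ≤ 2 * C := by
  have h1 := abs_le.1 (abs_integral_le_of_abs_le (μ := ν) (hC x))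
  have h2 := abs_le.1 (abs_integral_le_of_abs_le (μ := ν) fun y => hC y x)
  rw [hajekProj, abs_le]
  constructor <;> linarith

lemma abs_hoeffdingRem_le (hC : ∀ x y, |h x y| ≤ C) (x y : E) :
    |hoeffdingRem ν h x y| ≤ 4 * C := by
  have h0 := abs_le.1 (hC x y)
  have h1 := abs_le.1 (abs_integral_le_of_abs_le (μ := ν) (hC x))
  have h2 := abs_le.1 (abs_integral_le_of_abs_le (μ := ν) fun z => hC z y)
  have h3 := abs_le.1 (abs_integral_le_of_abs_le (μ := ν.prod ν) fun z => hC z.1 z.2)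
  rw [hoeffdingRem, abs_le]
  constructor <;> linarith

lemma integrable_of_abs_le {F : Type*} [MeasurableSpace F] {μ : Measure F}
    [IsProbabilityMeasure μ] {f : F → ℝ} (hm : Measurable f) (hf : ∀ x, |f x| ≤ C) :
    Integrable f μ :=
  .of_bound hm.aestronglyMeasurable C (ae_of_all _ hf)

lemma integral_integral_eq (hm : Measurable h.uncurry) (hC : ∀ x y, |h x y| ≤ C) :
    ∫ x, ∫ y, h x y ∂ν ∂ν = ∫ z, h z.1 z.2 ∂(ν.prod ν) :=
  (integral_prod _ (integrable_of_abs_le (C := C) hm fun z => hC z.1 z.2)).symm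

lemma integral_integral_eq_symm (hm : Measurable h.uncurry) (hC : ∀ x y, |h x y| ≤ C) :
    ∫ y, ∫ x, h x y ∂ν ∂ν = ∫ z, h z.1 z.2 ∂(ν.prod ν) :=
  (integral_prod_symm _ (integrable_of_abs_le (C := C) hm fun z => hC z.1 z.2)).symm

lemma integral_hajekProj (hm : Measurable h.uncurry) (hC : ∀ x y, |h x y| ≤ C) :
    ∫ x, hajekProj ν h x ∂ν = 2 * ∫ z, h z.1 z.2 ∂(ν.prod ν) := by
  unfold hajekProj
  rw [integral_add (integrable_of_abs_le (measurable_integral_left hm)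
      fun x => abs_integral_le_of_abs_le (hC x))
    (integrable_of_abs_le (measurable_integral_right hm)
      fun x => abs_integral_le_of_abs_le fun y => hC y x),
    integral_integral_eq hm hC, integral_integral_eq_symm hm hC]
  ring

lemma integral_hoeffdingRem_left (hm : Measurable h.uncurry) (hC : ∀ x y, |h x y| ≤ C) (y : E) :
    ∫ x, hoeffdingRem ν h x y ∂ν = 0 := by
  have i1 : Integrable (fun x => h x y) ν :=
    integrable_of_abs_le (hm.comp measurable_prodMk_right) fun x => hC x y
  have i2 : Integrable (fun x => ∫ z, h x z ∂ν) ν :=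
    integrable_of_abs_le (measurable_integral_left hm) fun x => abs_integral_le_of_abs_le (hC x)
  have i3 : Integrable (fun x => h x y - ∫ z, h x z ∂ν) ν := i1.sub i2
  have i4 : Integrable (fun x => h x y - ∫ z, h x z ∂ν - ∫ z, h z y ∂ν) ν :=
    i3.sub (integrable_const _)
  unfold hoeffdingRem
  rw [integral_add i4 (integrable_const _), integral_sub i3 (integrable_const _),
    integral_sub i1 i2, integral_integral_eq hm hC]
  simp

lemma integral_hoeffdingRem_right (hm : Measurable h.uncurry) (hC : ∀ x y, |h x y| ≤ C) (x : E) :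
    ∫ y, hoeffdingRem ν h x y ∂ν = 0 := by
  have i1 : Integrable (fun y => h x y) ν :=
    integrable_of_abs_le (hm.comp measurable_prodMk_left) fun y => hC x y
  have i2 : Integrable (fun y => ∫ z, h z y ∂ν) ν :=
    integrable_of_abs_le (measurable_integral_right hm)
      fun y => abs_integral_le_of_abs_le fun z => hC z y
  have i3 : Integrable (fun y => h x y - ∫ z, h x z ∂ν) ν := i1.sub (integrable_const _)
  have i4 : Integrable (fun y => h x y - ∫ z, h x z ∂ν - ∫ z, h z y ∂ν) ν := i3.sub i2
  unfold hoeffdingRem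
  rw [integral_add i4 (integrable_const _), integral_sub i3 i2,
    integral_sub i1 (integrable_const _), integral_integral_eq_symm hm hC]
  simp

lemma sum_sum_erase_eq_sum_offDiag (s : Finset ℕ) (f : ℕ → ℕ → ℝ) :
    ∑ i ∈ s, ∑ j ∈ s.erase i, f i j = ∑ a ∈ s.offDiag, f a.1 a.2 := by
  refine (Finset.sum_finset_product' _ _ _ fun a => ?_).symm
  simp only [Finset.mem_offDiag, Finset.mem_erase]
  tauto

end UStatistic

/-- Hoeffding decomposition of a U-statistic of order two. -/
lemma hoeffding_decomposition {E : Type*} [MeasurableSpace E] (ν : Measure E)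
    (h : E → E → ℝ) {n : ℕ} (hn : 2 ≤ n) (x : ℕ → E) :
    1 / ((n : ℝ) * ((n : ℝ) - 1)) * ∑ i ∈ Finset.range n, ∑ j ∈ (Finset.range n).erase i,
        h (x i) (x j) - ∫ z, h z.1 z.2 ∂(ν.prod ν) =
      (n : ℝ)⁻¹ * (∑ i ∈ Finset.range n, hajekProj ν h (x i) -
        n * (2 * ∫ z, h z.1 z.2 ∂(ν.prod ν))) +
      1 / ((n : ℝ) * ((n : ℝ) - 1)) *
        ∑ a ∈ (Finset.range n).offDiag, hoeffdingRem ν h (x a.1) (x a.2) := by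
  have hn2 : (2 : ℝ) ≤ n := by exact_mod_cast hn
  have hn0 : (n : ℝ) ≠ 0 := by linarith
  have hn1 : (n : ℝ) - 1 ≠ 0 := by linarith
  have hcard {i : ℕ} (hi : i ∈ Finset.range n) :
      (((Finset.range n).erase i).card : ℝ) = n - 1 := by
    rw [Finset.card_erase_of_mem hi, Finset.card_range, Nat.cast_sub (by lia), Nat.cast_one]
  have hfst (f : E → ℝ) : ∑ i ∈ Finset.range n, ∑ _j ∈ (Finset.range n).erase i, f (x i) =
      (n - 1) * ∑ i ∈ Finset.range n, f (x i) := by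
    rw [Finset.mul_sum]
    refine Finset.sum_congr rfl fun i hi => ?_
    rw [Finset.sum_const, nsmul_eq_mul, hcard hi]
  have hsnd (f : E → ℝ) : ∑ i ∈ Finset.range n, ∑ j ∈ (Finset.range n).erase i, f (x j) =
      (n - 1) * ∑ i ∈ Finset.range n, f (x i) := by
    rw [← hfst, Finset.sum_comm' (t' := Finset.range n) (s' := fun j => (Finset.range n).erase j)]
    intro i j
    simp only [Finset.mem_erase]
    tauto
  rw [← sum_sum_erase_eq_sum_offDiag (Finset.range n) fun i j => hoeffdingRem ν h (x i) (x j)]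
  simp only [hoeffdingRem, hajekProj, Finset.sum_add_distrib, Finset.sum_sub_distrib]
  rw [hfst fun x => ∫ z, h x z ∂ν, hsnd fun y => ∫ z, h z y ∂ν,
    hfst fun _ => ∫ z, h z.1 z.2 ∂(ν.prod ν), Finset.sum_const, Finset.card_range, nsmul_eq_mul]
  field_simp
  ring

/-! ### From mean square convergence to convergence in probability. -/

open scoped Topology

/-- Convergence to zero in mean square implies convergence in probability. -/
lemma tendstoInMeasure_zero_of_tendsto_integral_sq {Ω V : Type*} [MeasurableSpace Ω]
    {P : Measure Ω} [IsProbabilityMeasure P] [NormedAddCommGroup V] {Y : ℕ → Ω → V}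
    (hint : ∀ᶠ n in atTop, Integrable (fun ω => ‖Y n ω‖ ^ 2) P)
    (hlim : Tendsto (fun n => ∫ ω, ‖Y n ω‖ ^ 2 ∂P) atTop (𝓝 0)) :
    TendstoInMeasure P Y atTop 0 := by
  rw [tendstoInMeasure_iff_measureReal_norm]
  intro ε hε
  have hlim' : Tendsto (fun n => (ε ^ 2)⁻¹ * ∫ ω, ‖Y n ω‖ ^ 2 ∂P) atTop (𝓝 0) := by
    simpa using hlim.const_mul (ε ^ 2)⁻¹
  refine squeeze_zero' (Eventually.of_forall fun n => measureReal_nonneg) ?_ hlim'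
  filter_upwards [hint] with n hn
  have hM := mul_meas_ge_le_integral_of_nonneg (ae_of_all P fun ω => sq_nonneg ‖Y n ω‖) hn (ε ^ 2)
  rw [le_inv_mul_iff₀ (by positivity)]
  refine le_trans (mul_le_mul_of_nonneg_left (measureReal_mono fun ω hω => ?_) (sq_nonneg ε)) hM
  simp only [Set.mem_ofPred_eq, Pi.zero_apply, sub_zero] at hω ⊢
  exact pow_le_pow_left₀ hε.le hω 2

/-! ### The concordance kernel, its projection, and the identification of `Σ`. -/

namespace CondKendall

variable {q m : ℕ}

/-- The kernel of the U-statistic `DHat A`. -/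
noncomputable def concKernel (A : Set (Fin q → ℝ)) (x y : Vec q) : ℝ :=
  (concPairs A).indicator (fun _ => (1 : ℝ)) (x, y)

/-- The indicator of `condEvent A`. -/
noncomputable def condInd (A : Set (Fin q → ℝ)) : Vec q → ℝ :=
  (condEvent A).indicator fun _ => (1 : ℝ)

@[fun_prop]
lemma measurable_blockJ : Measurable (blockJ (q := q)) := by
  unfold blockJ
  fun_prop

lemma measurableSet_condEvent {A : Set (Fin q → ℝ)} (hA : MeasurableSet A) :
    MeasurableSet (condEvent A) :=
  measurable_blockJ hA

lemma measurableSet_ltPairs : MeasurableSet (ltPairs q) := by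
  have hlt (i : Fin (q + 2)) : MeasurableSet {z : Vec q × Vec q | z.1 i < z.2 i} :=
    measurableSet_lt (by fun_prop) (by fun_prop)
  exact (hlt 0).inter (hlt 1)

lemma concPairs_eq (A : Set (Fin q → ℝ)) :
    concPairs A = ltPairs q ∩ (condEvent A ×ˢ condEvent A) := by
  ext z
  simp [concPairs, ltPairs, condEvent, and_assoc]

lemma measurableSet_concPairs {A : Set (Fin q → ℝ)} (hA : MeasurableSet A) :
    MeasurableSet (concPairs A) := by
  rw [concPairs_eq]
  exact measurableSet_ltPairs.inter ((measurableSet_condEvent hA).prod (measurableSet_condEvent hA))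

lemma measurable_concKernel {A : Set (Fin q → ℝ)} (hA : MeasurableSet A) :
    Measurable (concKernel A).uncurry :=
  measurable_const.indicator (measurableSet_concPairs hA)

lemma measurable_condInd {A : Set (Fin q → ℝ)} (hA : MeasurableSet A) :
    Measurable (condInd A) :=
  measurable_const.indicator (measurableSet_condEvent hA)

lemma abs_concKernel_le (A : Set (Fin q → ℝ)) (x y : Vec q) : |concKernel A x y| ≤ 1 := by
  by_cases h : (x, y) ∈ concPairs A <;> simp [concKernel, h]

lemma abs_condInd_le (A : Set (Fin q → ℝ)) (x : Vec q) : |condInd A x| ≤ 1 := by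
  by_cases h : x ∈ condEvent A <;> simp [condInd, h]

/-- The `2` cancels the `1/2` in `symKernel`. The condition on `y` stays an indicator so that
`mul_integral_condLaw` can absorb it into the conditional law. -/
lemma concKernel_add_swap (A : Set (Fin q → ℝ)) (x y : Vec q) :
    concKernel A x y + concKernel A y x =
      2 * condInd A x * (condEvent A).indicator (fun y => symKernel y x) y := by
  by_cases hx : x ∈ condEvent A <;> by_cases hy : y ∈ condEvent A <;>
    by_cases h : (x, y) ∈ ltPairs q <;> by_cases h' : (y, x) ∈ ltPairs q <;>
    norm_num [concKernel, condInd, symKernel, concPairs_eq, hx, hy, h, h']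

lemma condInd_inter (A B : Set (Fin q → ℝ)) (x : Vec q) :
    condInd (A ∩ B) x = condInd A x * condInd B x := by
  have : condEvent (A ∩ B) = condEvent A ∩ condEvent B := rfl
  by_cases hx : x ∈ condEvent A <;> by_cases hy : x ∈ condEvent B <;>
    simp [condInd, this, hx, hy]

variable (ν : Measure (Vec q))

lemma integral_condInd {A : Set (Fin q → ℝ)} (hA : MeasurableSet A) :
    ∫ x, condInd A x ∂ν = p ν A :=
  integral_indicator_one (measurableSet_condEvent hA)

lemma integral_concKernel {A : Set (Fin q → ℝ)} (hA : MeasurableSet A) :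
    ∫ z, concKernel A z.1 z.2 ∂(ν.prod ν) = D ν A :=
  integral_indicator_one (measurableSet_concPairs hA)

lemma mul_integral_condLaw {A : Set (Fin q → ℝ)} (hA : MeasurableSet A) (hpos : 0 < p ν A)
    (f : Vec q → ℝ) :
    p ν A * ∫ y, f y ∂(condLaw ν A) = ∫ y, (condEvent A).indicator f y ∂ν := by
  rw [condLaw, ProbabilityTheory.cond, integral_smul_measure,
    integral_indicator (measurableSet_condEvent hA), ENNReal.toReal_inv, smul_eq_mul,
    ← mul_assoc]
  change p ν A * (p ν A)⁻¹ * _ = _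
  rw [mul_inv_cancel₀ hpos.ne', one_mul]

/-- The Hájek projection of the concordance kernel in terms of the conditional law. -/
lemma hajekProj_concKernel [IsProbabilityMeasure ν] {A : Set (Fin q → ℝ)} (hA : MeasurableSet A) (hpos : 0 < p ν A)
    (x : Vec q) :
    hajekProj ν (concKernel A) x =
      2 * p ν A * (condInd A x * ∫ y, symKernel y x ∂(condLaw ν A)) := by
  have hm := measurable_concKernel hA
  have hi := abs_concKernel_le A
  calc hajekProj ν (concKernel A) x
      = ∫ y, (concKernel A x y + concKernel A y x) ∂ν := by
        refine (integral_add ?_ ?_).symm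
        · exact integrable_of_abs_le (hm.comp measurable_prodMk_left) (hi x)
        · exact integrable_of_abs_le (hm.comp measurable_prodMk_right) fun y => hi y x
    _ = 2 * condInd A x * (p ν A * ∫ y, symKernel y x ∂(condLaw ν A)) := by
        simp_rw [concKernel_add_swap]
        rw [integral_const_mul, mul_integral_condLaw ν hA hpos]
    _ = _ := by ring

/-- For fixed `x₃` the integrand is a product of a function of `x₁` and a function of `x₂`, so the
triple integral becomes the second moment of two projections, up to the constants `2 p`. -/
lemma intI_eq (A B : Set (Fin q → ℝ)) :
    intI ν A B = ∫ x, (condInd A x * ∫ y, symKernel y x ∂(condLaw ν A)) *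
      (condInd B x * ∫ y, symKernel y x ∂(condLaw ν B)) ∂ν := by
  unfold intI
  simp_rw [integral_mul_const, integral_const_mul]
  refine integral_congr_ae (ae_of_all _ fun x => ?_)
  change condInd (A ∩ B) x * _ * _ = _
  rw [condInd_inter]
  ring

lemma intJ_eq (A B : Set (Fin q → ℝ)) :
    intJ ν A B = ∫ x, (condInd A x * ∫ y, symKernel y x ∂(condLaw ν A)) * condInd B x ∂ν := by
  unfold intJ
  simp_rw [integral_const_mul]
  refine integral_congr_ae (ae_of_all _ fun x => ?_)
  change condInd (A ∩ B) x * _ = _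
  rw [condInd_inter]
  ring

/-- The influence functions of the components of `VHat`. -/
noncomputable def influence (A : Fin m → Set (Fin q → ℝ)) : Fin m ⊕ Fin m → Vec q → ℝ :=
  Sum.elim (fun k => hajekProj ν (concKernel (A k))) fun k => condInd (A k)

lemma integral_influence_inr {A : Fin m → Set (Fin q → ℝ)}
    (hA : ∀ k, MeasurableSet (A k))
    (k : Fin m) :
    ∫ x, influence ν A (.inr k) x ∂ν = p ν (A k) :=
  integral_condInd ν (hA k)

variable [IsProbabilityMeasure ν] {A : Fin m → Set (Fin q → ℝ)}

lemma measurable_influence (hA : ∀ k, MeasurableSet (A k))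
    (a : Fin m ⊕ Fin m) : Measurable (influence ν A a) := by
  rcases a with k | k
  · exact measurable_hajekProj (measurable_concKernel (hA k))
  · exact measurable_condInd (hA k)

lemma memLp_influence (hA : ∀ k, MeasurableSet (A k))
    (a : Fin m ⊕ Fin m) : MemLp (influence ν A a) 2 ν := by
  refine .of_bound (measurable_influence ν hA a).aestronglyMeasurable 2 (ae_of_all _ fun x => ?_)
  rcases a with k | k
  · simpa [influence] using abs_hajekProj_le (ν := ν) (abs_concKernel_le (A k)) x
  · exact (abs_condInd_le (A k) x).trans one_le_two

lemma integral_influence_inl (hA : ∀ k, MeasurableSet (A k))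
    (k : Fin m) :
    ∫ x, influence ν A (.inl k) x ∂ν = 2 * D ν (A k) :=
  (integral_hajekProj (measurable_concKernel (hA k)) (abs_concKernel_le (A k))).trans
    (by rw [integral_concKernel ν (hA k)])

/-- `SigmaMat` is the covariance matrix of the influence functions. -/
lemma covariance_influence (hA : ∀ k, MeasurableSet (A k))
    (hpos : ∀ k, 0 < p ν (A k)) :
    (Matrix.of fun a b => cov[influence ν A a, influence ν A b; ν]) = SigmaMat ν A := by
  have hproj k : influence ν A (.inl k) = fun x =>
      2 * p ν (A k) * (condInd (A k) x * ∫ y, symKernel y x ∂(condLaw ν (A k))) :=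
    funext fun x => hajekProj_concKernel ν (hA k) (hpos k) x
  have hmix k l : cov[influence ν A (.inl k), influence ν A (.inr l); ν] =
      2 * p ν (A k) * intJ ν (A k) (A l) - 2 * D ν (A k) * p ν (A l) := by
    rw [covariance_eq_sub (memLp_influence ν hA _) (memLp_influence ν hA _),
      integral_influence_inl ν hA, integral_influence_inr ν hA, intJ_eq, ← integral_const_mul]
    congr 1
    refine integral_congr_ae (ae_of_all _ fun x => ?_)
    rw [hproj]
    simp only [Pi.mul_apply, influence, Sum.elim_inr]
    ring
  ext a b
  rcases a with k | k <;> rcases b with l | l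
  · simp only [Matrix.of_apply, SigmaMat, Matrix.fromBlocks_apply₁₁, Sigma11]
    rw [covariance_eq_sub (memLp_influence ν hA _) (memLp_influence ν hA _),
      integral_influence_inl ν hA, integral_influence_inl ν hA, intI_eq, ← integral_const_mul]
    congr 1
    · refine integral_congr_ae (ae_of_all _ fun x => ?_)
      rw [hproj, hproj]
      simp only [Pi.mul_apply]
      ring
    · ring
  · exact hmix k l
  · simp only [Matrix.of_apply, SigmaMat, Matrix.fromBlocks_apply₂₁, Matrix.transpose_apply]
    rw [covariance_comm]
    exact hmix l k
  · simp only [Matrix.of_apply, SigmaMat, Matrix.fromBlocks_apply₂₂, Sigma22]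
    rw [covariance_eq_sub (memLp_influence ν hA _) (memLp_influence ν hA _),
      integral_influence_inr ν hA, integral_influence_inr ν hA,
      ← integral_condInd ν ((hA k).inter (hA l))]
    congr 1
    exact integral_congr_ae (ae_of_all _ fun x => (condInd_inter (A k) (A l) x).symm)

end CondKendall

/-! ### Linearization of `VHat` and the conclusion. -/

namespace CondKendall

lemma aemeasurable_VHat {Ω : Type*} [MeasurableSpace Ω] {P : Measure Ω} {q m : ℕ}
    {ν : Measure (Vec q)} {X : ℕ → Ω → Vec q} {A : Fin m → Set (Fin q → ℝ)}
    (hX : ∀ i, AEMeasurable (X i) P) (hA : ∀ k, MeasurableSet (A k)) (n : ℕ) :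
    AEMeasurable (fun ω => VHat ν A n fun i => X i ω) P := by
  refine (WithLp.measurable_toLp 2 (Fin m ⊕ Fin m → ℝ)).comp_aemeasurable ?_
  refine aemeasurable_pi_lambda _ fun a => ?_
  rcases a with k | k
  · refine ((Finset.aemeasurable_fun_sum _ fun i _ => Finset.aemeasurable_fun_sum _
      fun j _ => ?_).const_mul _).sub_const _
    exact (measurable_concKernel (hA k)).comp_aemeasurable ((hX i).prodMk (hX j))
  · refine ((Finset.aemeasurable_fun_sum _ fun i _ => ?_).const_mul _).sub_const _
    exact (measurable_condInd (hA k)).comp_aemeasurable (hX i)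

variable {Ω : Type*} [MeasurableSpace Ω] {P : Measure Ω} [IsProbabilityMeasure P]
  {q m : ℕ} {ν : Measure (Vec q)} [IsProbabilityMeasure ν] {X : ℕ → Ω → Vec q}
  {A : Fin m → Set (Fin q → ℝ)}

/-- The normalized sum of the centered influence functions. -/
noncomputable def linearPart (ν : Measure (Vec q)) (A : Fin m → Set (Fin q → ℝ)) (n : ℕ)
    (x : ℕ → Vec q) : EuclideanSpace ℝ (Fin m ⊕ Fin m) :=
  WithLp.toLp 2 fun a =>
    (√(n : ℝ))⁻¹ * (∑ i ∈ Finset.range n, influence ν A a (x i) - n * ∫ x, influence ν A a x ∂ν)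

/-- Only the degenerate parts of the U-statistics survive; the frequency components are exactly
linear and contribute nothing. -/
lemma norm_sq_sub_linearPart (hA : ∀ k, MeasurableSet (A k)) {n : ℕ} (hn : 2 ≤ n)
    (x : ℕ → Vec q) :
    ‖√(n : ℝ) • VHat ν A n x - linearPart ν A n x‖ ^ 2 =
      ∑ k, n * (1 / ((n : ℝ) * (n - 1))) ^ 2 *
        (∑ a ∈ (Finset.range n).offDiag, hoeffdingRem ν (concKernel (A k)) (x a.1) (x a.2)) ^ 2 := by
  have hs : √(n : ℝ) * √(n : ℝ) = n := Real.mul_self_sqrt (Nat.cast_nonneg n)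
  have hn0 : (n : ℝ) ≠ 0 := by positivity
  have hinv : (√(n : ℝ))⁻¹ = √(n : ℝ) * (n : ℝ)⁻¹ := by
    rw [← div_eq_mul_inv, Real.sqrt_div_self]
  have hinl (k : Fin m) : (√(n : ℝ) • VHat ν A n x - linearPart ν A n x) (.inl k) =
      √(n : ℝ) * (1 / ((n : ℝ) * (n - 1)) * ∑ a ∈ (Finset.range n).offDiag,
        hoeffdingRem ν (concKernel (A k)) (x a.1) (x a.2)) := by
    have hdec := hoeffding_decomposition ν (concKernel (A k)) hn x
    rw [integral_concKernel ν (hA k)] at hdec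
    have hV : VHat ν A n x (.inl k) = _ := hdec
    simp only [PiLp.sub_apply, PiLp.smul_apply, smul_eq_mul, hV, linearPart,
      integral_influence_inl ν hA, hinv]
    simp only [influence, Sum.elim_inl]
    ring
  have hinr (k : Fin m) : (√(n : ℝ) • VHat ν A n x - linearPart ν A n x) (.inr k) = 0 := by
    have hV : VHat ν A n x (.inr k) =
      1 / (n : ℝ) * ∑ i ∈ Finset.range n, condInd (A k) (x i) - p ν (A k) := rfl
    simp only [PiLp.sub_apply, PiLp.smul_apply, smul_eq_mul, hV, linearPart,
      integral_influence_inr ν hA, hinv]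
    simp only [influence, Sum.elim_inr]
    field_simp
    ring
  rw [EuclideanSpace.real_norm_sq_eq, Fintype.sum_sum_type]
  simp only [hinl, hinr]
  simp only [mul_pow, sq √(n : ℝ), hs]
  simp [mul_assoc]

lemma tendstoInMeasure_sub_linearPart (hindep : iIndepFun X P) (hlaw : ∀ i, HasLaw (X i) ν P)
    (hA : ∀ k, MeasurableSet (A k)) :
    TendstoInMeasure P (fun (n : ℕ) ω => √(n : ℝ) • VHat ν A n (fun i => X i ω) -
      linearPart ν A n fun i => X i ω) atTop 0 := by
  have hX i : AEMeasurable (X i) P := (hlaw i).aemeasurable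
  have hrm k := measurable_hoeffdingRem (ν := ν) (measurable_concKernel (hA k))
  have hrC k (x y : Vec q) : |hoeffdingRem ν (concKernel (A k)) x y| ≤ 4 := by
    simpa using abs_hoeffdingRem_le (ν := ν) (abs_concKernel_le (A k)) x y
  have hint (n : ℕ) (k : Fin m) : Integrable (fun ω => (∑ a ∈ (Finset.range n).offDiag,
      hoeffdingRem ν (concKernel (A k)) (X a.1 ω) (X a.2 ω)) ^ 2) P := by
    refine MemLp.integrable_sq (memLp_finsetSum _ fun a _ => ?_)
    exact .of_bound ((hrm k).comp_aemeasurable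
      ((hX a.1).prodMk (hX a.2))).aestronglyMeasurable 4 (ae_of_all _ fun ω => hrC k _ _)
  apply tendstoInMeasure_zero_of_tendsto_integral_sq
  · filter_upwards [eventually_ge_atTop 2] with n hn
    simp_rw [norm_sq_sub_linearPart hA hn]
    exact integrable_finsetSum _ fun k _ => (hint n k).const_mul _
  -- Here `32 = 2 * 4 ^ 2`: the kernel is bounded by `1`, hence its degenerate part by `4`, and
  -- there are `m` components.
  · have hlim : Tendsto (fun n : ℕ => (32 * m : ℝ) / ((n : ℝ) - 1)) atTop (𝓝 0) :=
      tendsto_const_nhds.div_atTop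
        (tendsto_atTop_add_const_right _ (-1) tendsto_natCast_atTop_atTop)
    refine squeeze_zero' (Eventually.of_forall fun n => integral_nonneg fun ω => sq_nonneg _) ?_ hlim
    filter_upwards [eventually_ge_atTop 2] with n hn
    have hn2 : (2 : ℝ) ≤ n := by exact_mod_cast hn
    have hn0 : (n : ℝ) ≠ 0 := by linarith
    have hn1 : (n : ℝ) - 1 ≠ 0 := by linarith
    simp_rw [norm_sq_sub_linearPart hA hn]
    rw [integral_finsetSum _ fun k _ => (hint n k).const_mul _]
    calc _ ≤ ∑ _k : Fin m, n * (1 / ((n : ℝ) * (n - 1))) ^ 2 * (2 * 4 ^ 2 * (n * (n - 1))) := by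
          refine Finset.sum_le_sum fun k _ => ?_
          rw [integral_const_mul]
          refine mul_le_mul_of_nonneg_left ?_ (by positivity)
          exact integral_sq_sum_offDiag_le hindep hlaw (hrm k) (hrC k)
            (integral_hoeffdingRem_left (measurable_concKernel (hA k)) (abs_concKernel_le (A k)))
            (integral_hoeffdingRem_right (measurable_concKernel (hA k)) (abs_concKernel_le (A k))) n
      _ = (32 * m : ℝ) / ((n : ℝ) - 1) := by
          rw [Finset.sum_const, Finset.card_univ, Fintype.card_fin, nsmul_eq_mul]
          field_simp
          ring

end CondKendall

/-- `X 0, X 1, …` are i.i.d. with law `ν` on `ℝ^(q+2)`, and `A k` are Borel sets of the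
conditioning block with positive probability, possibly overlapping. `SigmaMat ν A` is a covariance
matrix, and `√n • V̂` converges in law to the centered Gaussian with this covariance matrix. -/
theorem mainTheorem1 {Ω : Type*} [MeasurableSpace Ω] (P : Measure Ω) [IsProbabilityMeasure P]
    (q m : ℕ) (ν : Measure (CondKendall.Vec q)) [IsProbabilityMeasure ν]
    (X : ℕ → Ω → CondKendall.Vec q)
    (hindep : iIndepFun X P) (hlaw : ∀ i, HasLaw (X i) ν P)
    (A : Fin m → Set (Fin q → ℝ)) (hA : ∀ k, MeasurableSet (A k))
    (hpos : ∀ k, 0 < CondKendall.p ν (A k)) :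
    (CondKendall.SigmaMat ν A).PosSemidef ∧
    TendstoInDistribution
      (fun (n : ℕ) (ω : Ω) => Real.sqrt n • CondKendall.VHat ν A n (fun i => X i ω))
      atTop id (fun _ => P)
      (multivariateGaussian 0 (CondKendall.SigmaMat ν A)) := by
  rw [← CondKendall.covariance_influence ν hA hpos]
  refine ⟨posSemidef_covariance _ (CondKendall.memLp_influence ν hA), ?_⟩
  have hclt := tendstoInDistribution_multivariate hindep hlaw _
    (CondKendall.measurable_influence ν hA) (CondKendall.memLp_influence ν hA)
  -- Slutsky: an error tending to zero in probability does not change the limit law.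
  refine tendstoInDistribution_of_tendstoInMeasure_sub _ _ hclt
    (CondKendall.tendstoInMeasure_sub_linearPart hindep hlaw hA) fun n => ?_
  exact (CondKendall.aemeasurable_VHat (fun i => (hlaw i).aemeasurable) hA n).const_smul (Real.sqrt n)
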